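/- Let $k$ be a differential field of characteristic $0$ with derivation $a\mapsto a'$ whose field of constants $C=\{c\in k : c'=0\}$ is algebraically closed. Let $k[\partial]$ be the ring of linear differential operators over $k$ (with $\partial a=a'+a\partial$ for $a\in k$), let $L\in k[\partial]$ be nonzero of order $n$, and let $A_L$ be the companion matrix of $L$. Let $K$ be a Picard--Vessiot field of $k$ for $L(Y)=0$, that is, the field of fractions of a differential ring $R$ over $k$ which has no differential ideals other than $(0)$ and $R\ne(0)$ and which is generated over $k$ by the entries and the inverse determinant of some $Z\in \mathrm{GL}_n(R)$ with $Z'=A_LZ$. Let $G$ be the differential Galois group of $K$ over $k$ (the $k$-automorphisms of $K$ that commute with the derivation), and let $V=\{y\in K : L(y)=0\}$, a vector space over $C$. 1. Let $z\in V$, $z\neq 0$, and $u=z'/z$. Then the following are equivalent: (a) the $C$-span of $z$ is a one-dimensional $G$-invariant subspace; (b) $u$ is left fixed by $G$; (c) $u\in k$. In this case $\partial-u$ is a right divisor of $L$ in $k[\partial]$. 2. Conversely, let $u\in k$ be such that $\partial-u$ is a right divisor of $L$ in $k[\partial]$. Then there is a nonzero solution $z\in V$ with $z'/z=u$; moreover,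 every nonzero $z\in K$ with $z'/z=u$ lies in $V$ and spans a one-dimensional $G$-invariant subspace over $C$. -/

import Mathlib

open scoped Differential Polynomial

noncomputable section

/-- The carrier of the ring `k[∂]` of linear differential operators over a differential field `k`.
The operator `a₀ + a₁ ∂ + ⋯ + aₙ ∂ⁿ` is stored as the polynomial with coefficients `a₀, …, aₙ`;
only the additive structure of polynomials is inherited, the product is defined below. -/
def DiffOp (k : Type*) [Field k] : Type _ := k[X]

namespace DiffOp

variable {k : Type*} [Field k]

instance instAddCommGroup : AddCommGroup (DiffOp k) := inferInstanceAs (AddCommGroup k[X])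

/-- The coefficients of an operator, as a polynomial. -/
def toPoly (L : DiffOp k) : k[X] := L

/-- The operator with given coefficients. -/
def ofPoly (p : k[X]) : DiffOp k := p

/-- An element `a` of `k`, seen as the operator `a` of order zero. -/
def const (a : k) : DiffOp k := ofPoly (Polynomial.C a)

/-- The operator `∂`. -/
def partialOp : DiffOp k := ofPoly Polynomial.X

/-- The order of a (nonzero) operator. -/
def order (L : DiffOp k) : ℕ := L.toPoly.natDegree

variable [Differential k]

/-- Left multiplication by `∂`: `∂ · ∑ bⱼ ∂ʲ = ∑ (bⱼ′ ∂ʲ + bⱼ ∂ʲ⁺¹)`. -/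
def partialMul (p : k[X]) : k[X] := Differential.mapCoeffs p + Polynomial.X * p

/-- The product `(∑ aᵢ ∂ⁱ) · M = ∑ aᵢ (∂ · (∂ · ⋯ (∂ · M)))`. -/
def mulPoly (L M : k[X]) : k[X] := L.sum fun i a => Polynomial.C a * partialMul^[i] M

lemma partialMul_add (p q : k[X]) : partialMul (p + q) = partialMul p + partialMul q := by
  simp only [partialMul, map_add]; ring

lemma partialMul_zero : partialMul (0 : k[X]) = 0 := by simp [partialMul]

lemma partialMul_iterate_add (i : ℕ) (p q : k[X]) :
    partialMul^[i] (p + q) = partialMul^[i] p + partialMul^[i] q := by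
  induction i with
  | zero => rfl
  | succ i ih => simp only [Function.iterate_succ_apply', ih, partialMul_add]

lemma partialMul_iterate_zero (i : ℕ) : partialMul^[i] (0 : k[X]) = 0 := by
  induction i with
  | zero => rfl
  | succ i ih => simp only [Function.iterate_succ_apply', ih, partialMul_zero]

lemma partialMul_iterate_one (i : ℕ) : partialMul^[i] (1 : k[X]) = Polynomial.X ^ i := by
  induction i with
  | zero => rfl
  | succ i ih =>
    rw [Function.iterate_succ_apply', ih, partialMul, ← Polynomial.monomial_one_right_eq_X_pow,
      Differential.mapCoeffs_monomial]
    simp [Polynomial.monomial_one_right_eq_X_pow, pow_succ']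

lemma mulPoly_add_left (L M N : k[X]) : mulPoly (L + M) N = mulPoly L N + mulPoly M N := by
  unfold mulPoly
  exact Polynomial.sum_add_index L M _ (by simp) (by intros; simp [add_mul])

lemma mulPoly_add_right (L M N : k[X]) : mulPoly L (M + N) = mulPoly L M + mulPoly L N := by
  simp only [mulPoly, partialMul_iterate_add, mul_add, Polynomial.sum, Finset.sum_add_distrib]

lemma mulPoly_zero_left (M : k[X]) : mulPoly 0 M = 0 := by simp [mulPoly]

lemma mulPoly_zero_right (M : k[X]) : mulPoly M 0 = 0 := by
  simp [mulPoly, partialMul_iterate_zero, Polynomial.sum]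

lemma mulPoly_monomial (i : ℕ) (a : k) (M : k[X]) :
    mulPoly (Polynomial.monomial i a) M = Polynomial.C a * partialMul^[i] M := by
  simp [mulPoly, Polynomial.sum_monomial_index]

lemma mulPoly_one_left (M : k[X]) : mulPoly 1 M = M := by
  simpa using mulPoly_monomial 0 (1 : k) M

lemma mulPoly_one_right (M : k[X]) : mulPoly M 1 = M := by
  simp only [mulPoly, partialMul_iterate_one]
  exact Polynomial.sum_C_mul_X_pow_eq M

lemma mulPoly_C_mul (a : k) (M N : k[X]) :
    mulPoly (Polynomial.C a * M) N = Polynomial.C a * mulPoly M N := by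
  induction M using Polynomial.induction_on' with
  | add p q hp hq => rw [mul_add, mulPoly_add_left, hp, hq, mulPoly_add_left, mul_add]
  | monomial i b =>
    rw [Polynomial.C_mul_monomial, mulPoly_monomial, mulPoly_monomial, map_mul, mul_assoc]

lemma mulPoly_partialMul (M N : k[X]) :
    mulPoly (partialMul M) N = partialMul (mulPoly M N) := by
  induction M using Polynomial.induction_on' with
  | add p q hp hq =>
    rw [partialMul_add, mulPoly_add_left, hp, hq, mulPoly_add_left, partialMul_add]
  | monomial i b =>
    have h : partialMul (Polynomial.monomial i b) =
        Polynomial.monomial i b′ + Polynomial.monomial (i + 1) b := by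
      simp [partialMul, Polynomial.X_mul_monomial]
    rw [h, mulPoly_add_left, mulPoly_monomial, mulPoly_monomial, mulPoly_monomial,
      Function.iterate_succ_apply']
    have h2 : Differential.mapCoeffs (Polynomial.C b) = Polynomial.C b′ := by
      simp
    simp only [partialMul, Derivation.leibniz, h2, smul_eq_mul]
    ring

lemma mulPoly_assoc (L M N : k[X]) : mulPoly (mulPoly L M) N = mulPoly L (mulPoly M N) := by
  induction L using Polynomial.induction_on' with
  | add p q hp hq => rw [mulPoly_add_left, mulPoly_add_left, hp, hq, mulPoly_add_left]
  | monomial i a =>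
    rw [mulPoly_monomial, mulPoly_C_mul, mulPoly_monomial]
    congr 1
    induction i with
    | zero => rfl
    | succ i ih => rw [Function.iterate_succ_apply', mulPoly_partialMul, ih,
        Function.iterate_succ_apply']

/-- The ring `k[∂]`. -/
instance instRing : Ring (DiffOp k) where
  __ := instAddCommGroup
  mul L M := ofPoly (mulPoly L.toPoly M.toPoly)
  one := ofPoly 1
  left_distrib L M N := mulPoly_add_right L M N
  right_distrib L M N := mulPoly_add_left L M N
  zero_mul M := mulPoly_zero_left M
  mul_zero M := mulPoly_zero_right M
  mul_assoc L M N := mulPoly_assoc L M N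
  one_mul M := mulPoly_one_left M
  mul_one M := mulPoly_one_right M
  zsmul := instAddCommGroup.zsmul
  zsmul_zero' := instAddCommGroup.zsmul_zero'
  zsmul_succ' := instAddCommGroup.zsmul_succ'
  zsmul_neg' := instAddCommGroup.zsmul_neg'
  neg_add_cancel := neg_add_cancel

/-- The defining relation `∂ a = a′ + a ∂` of `k[∂]`. -/
theorem partialOp_mul_const (a : k) :
    (partialOp : DiffOp k) * const a = const a′ + const a * partialOp := by
  change mulPoly Polynomial.X (Polynomial.C a) =
    Polynomial.C a′ + mulPoly (Polynomial.C a) Polynomial.X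
  have h2 : Differential.mapCoeffs (Polynomial.C a) = Polynomial.C a′ := by
    simp
  have h3 : mulPoly (Polynomial.C a) Polynomial.X = Polynomial.C a * Polynomial.X :=
    mulPoly_monomial 0 a Polynomial.X
  rw [h3, ← Polynomial.monomial_one_one_eq_X, mulPoly_monomial]
  simp only [map_one, one_mul, Function.iterate_one, partialMul, h2,
    Polynomial.monomial_one_one_eq_X]
  ring

/-- `D` is a right divisor of `L` in `k[∂]`: `L = Q D` for some `Q ∈ k[∂]`. -/
def IsRightDivisor (D L : DiffOp k) : Prop := ∃ Q : DiffOp k, L = Q * D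

/-- `L(y) = aₙ y⁽ⁿ⁾ + ⋯ + a₁ y′ + a₀ y` for `y` in a differential field `K` over `k`. -/
def eval (L : DiffOp k) {K : Type*} [Field K] [Differential K] [Algebra k K] (y : K) : K :=
  L.toPoly.sum fun i a => algebraMap k K a * (fun x : K => x′)^[i] y

/-- The companion matrix `A_L` of `L = aₙ ∂ⁿ + ⋯ + a₀`, `aₙ ≠ 0`: ones above the diagonal, last row
`(-a₀ / aₙ, …, -aₙ₋₁ / aₙ)`, so that `L(y) = 0` becomes `Y′ = A_L Y` for
`Y = (y, y′, …, y⁽ⁿ⁻¹⁾)`. -/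
def companion (L : DiffOp k) : Matrix (Fin L.order) (Fin L.order) k :=
  Matrix.of fun i j =>
    if (i : ℕ) + 1 = L.order then -(L.toPoly.coeff j) / L.toPoly.leadingCoeff
    else if (j : ℕ) = (i : ℕ) + 1 then 1 else 0

end DiffOp

/-- The field `C_k = {c ∈ k | c′ = 0}` of constants of a differential field `k`. -/
def constantField (k : Type*) [Field k] [Differential k] : Subfield k where
  carrier := {c | c′ = 0}
  zero_mem' := by simp
  one_mem' := by simp
  add_mem' := by
    intro a b (ha : a′ = 0) (hb : b′ = 0)
    simp [ha, hb]
  mul_mem' := by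
    intro a b (ha : a′ = 0) (hb : b′ = 0)
    simp [ha, hb]
  neg_mem' := by
    intro a (ha : a′ = 0)
    simp [ha]
  inv_mem' := by
    intro a (ha : a′ = 0)
    simp [Derivation.leibniz_inv, ha]

/-- `R` is a Picard-Vessiot ring over `k` for `Y′ = AY`: a simple differential ring over `k` that is
generated over `k` by the entries and the inverse determinant of some fundamental solution
matrix `Z ∈ GLₙ(R)` of `Y′ = AY`. -/
structure IsPicardVessiotRing {k : Type*} [Field k] [Differential k] {n : ℕ}
    (A : Matrix (Fin n) (Fin n) k) (R : Type*) [CommRing R] [Differential R] [Algebra k R]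
    [DifferentialAlgebra k R] : Prop where
  nontrivial : Nontrivial R
  simple : ∀ I : Ideal R, (∀ x ∈ I, x′ ∈ I) → I = ⊥ ∨ I = ⊤
  exists_fundamental : ∃ Z : GL (Fin n) R,
    (Z : Matrix (Fin n) (Fin n) R).map (fun x => x′) =
      A.map (algebraMap k R) * (Z : Matrix (Fin n) (Fin n) R) ∧
    Algebra.adjoin k
      (insert ((Matrix.GeneralLinearGroup.det Z)⁻¹ : Rˣ).val
        (Set.range fun p : Fin n × Fin n => (Z : Matrix (Fin n) (Fin n) R) p.1 p.2)) = ⊤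

section Extension

variable (k K : Type*) [Field k] [Differential k] [Field K] [Differential K] [Algebra k K]

/-- The differential Galois group of `K` over `k`: the `k`-automorphisms of the field `K` that
commute with the derivation. -/
def DGal : Subgroup (K ≃ₐ[k] K) where
  carrier := {σ | ∀ x : K, σ x′ = (σ x)′}
  one_mem' := fun x => rfl
  mul_mem' := by
    intro σ τ hσ hτ x
    rw [AlgEquiv.mul_apply, hτ x, hσ (τ x), AlgEquiv.mul_apply]
  inv_mem' := by
    intro σ hσ x
    apply σ.injective
    rw [hσ, ← AlgEquiv.mul_apply, ← AlgEquiv.mul_apply, mul_inv_cancel, AlgEquiv.one_apply,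
      AlgEquiv.one_apply]

variable {k}

/-- The solution space `V = {y ∈ K | L(y) = 0}`, as a vector space over the constants of `k`. -/
def DiffOp.solutionSpace [DifferentialAlgebra k K] (L : DiffOp k) :
    Submodule (constantField k) K where
  carrier := {y | L.eval y = 0}
  zero_mem' := by
    have h (i : ℕ) : (fun x : K => x′)^[i] (0 : K) = 0 := by
      induction i with
      | zero => rfl
      | succ i ih => simp only [Function.iterate_succ_apply', ih, map_zero]
    simp [DiffOp.eval, h, Polynomial.sum]
  add_mem' := by
    intro y z (hy : L.eval y = 0) (hz : L.eval z = 0)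
    have h (i : ℕ) : (fun x : K => x′)^[i] (y + z) =
        (fun x : K => x′)^[i] y + (fun x : K => x′)^[i] z := by
      induction i with
      | zero => rfl
      | succ i ih => simp only [Function.iterate_succ_apply', ih, map_add]
    have h2 : L.eval (y + z) = L.eval y + L.eval z := by
      simp only [DiffOp.eval, h, mul_add, Polynomial.sum, Finset.sum_add_distrib]
    change L.eval (y + z) = 0
    rw [h2, hy, hz, add_zero]
  smul_mem' := by
    intro c y (hy : L.eval y = 0)
    have hc : (algebraMap k K c)′ = 0 := by
      rw [deriv_algebraMap, show (c : k)′ = 0 from c.2, map_zero]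
    have h (i : ℕ) : (fun x : K => x′)^[i] (algebraMap k K c * y) =
        algebraMap k K c * (fun x : K => x′)^[i] y := by
      induction i with
      | zero => rfl
      | succ i ih => simp only [Function.iterate_succ_apply', ih, Derivation.leibniz, hc,
          smul_eq_mul, mul_zero, add_zero]
    have h2 : L.eval (algebraMap k K c * y) = algebraMap k K c * L.eval y := by
      simp only [DiffOp.eval, h, Polynomial.sum, Finset.mul_sum]
      exact Finset.sum_congr rfl fun i _ => by ring
    have h3 : c • y = algebraMap k K c * y := Algebra.smul_def (c : k) y
    change L.eval (c • y) = 0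
    rw [h3, h2, hy, mul_zero]

variable (k) {K}

/-- `z` spans a one-dimensional, `G`-invariant subspace over the constants of `k`, where `G` is the
differential Galois group of `K` over `k`. -/
def SpansInvariantLine (z : K) : Prop :=
  Module.finrank (constantField k) (Submodule.span (constantField k) {z}) = 1 ∧
    ∀ σ ∈ DGal k K, ∀ w ∈ Submodule.span (constantField k) {z},
      σ w ∈ Submodule.span (constantField k) {z}

end Extension

end

/-! Two facts about the Picard–Vessiot field `K` carry the theorem: its constants are those of `k`
(`exists_constant`), and the fixed field of `G` is `k` (`mem_range_of_forall_DGal`). An element `σ`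
of `G` fixes `z′ / z` exactly when `σ z / z` is a constant; the first fact makes that constant a
scalar, so (a) ⇔ (b), and the second gives (b) ⇔ (c). Writing `L = Q (∂ - u) + r` gives `L(z) = r z`
when `z′ = u z`, hence divisibility.

For the converse, a formal solution `y` of `y′ = u y` would have `(y, y′, …) = E y` with `E` over
`k`, and `E′ = A_L E - u E`. So the entries of `Z⁻¹ E` solve `f′ = -u f`; one of them is nonzero,
and its inverse is the solution sought.

For the fixed field, take `a = b / c` outside `k`. Then `d = b ⊗ c - c ⊗ b` is not nilpotent in `R ⊗
R`. A differential quotient of `R ⊗ R` that is maximal with `d` non-nilpotent has no new constants,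
so the two maps from `R` into it differ by an automorphism of `R`, and this moves `a`. Both facts
rest on `exists_constant_of_deriv_eq_zero`, which combines Chevalley's theorem with a minimal
polynomial argument. -/

/-! ### Constants of differential algebras of finite type. -/

open Polynomial in
/-- A constructible subset of the prime spectrum of a domain agrees, on a nonempty basic open set,
with the full set or the empty set, according to whether it contains the generic point. -/
theorem PrimeSpectrum.exists_ne_zero_forall_mem_iff_bot_mem {A : Type*} [CommRing A] [IsDomain A]
    {s : Set (PrimeSpectrum A)} (hs : Topology.IsConstructible s) :
    ∃ f : A, f ≠ 0 ∧ ∀ p : PrimeSpectrum A, f ∉ p.asIdeal → (p ∈ s ↔ ⊥ ∈ s) := by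
  induction hs using Topology.IsConstructible.empty_union_induction with
  | open_retrocompact U hU _ =>
    by_cases hb : (⊥ : PrimeSpectrum A) ∈ U
    · obtain ⟨_, ⟨f, rfl⟩, hf, hfU⟩ :=
        PrimeSpectrum.isTopologicalBasis_basic_opens.exists_subset_of_mem_open hb hU
      refine ⟨f, fun h => hf ?_, fun p hp => ?_⟩
      · simp [h]
      · exact iff_of_true (hfU hp) hb
    -- The generic point specializes to every point, so an open set missing it is empty.
    · refine ⟨1, one_ne_zero, fun p _ => iff_of_false (fun hp => hb ?_) hb⟩
      exact ((PrimeSpectrum.le_iff_specializes ⊥ p).1 bot_le).mem_open hU hp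
  | union s hs t ht ihs iht =>
    obtain ⟨f, hf, hfs⟩ := ihs
    obtain ⟨g, hg, hgt⟩ := iht
    refine ⟨f * g, mul_ne_zero hf hg, fun p hp => ?_⟩
    have h1 : f ∉ p.asIdeal := fun h => hp (Ideal.mul_mem_right _ _ h)
    have h2 : g ∉ p.asIdeal := fun h => hp (Ideal.mul_mem_left _ _ h)
    simp only [Set.mem_union, hfs p h1, hgt p h2]
  | compl s hs ih =>
    obtain ⟨f, hf, hfs⟩ := ih
    exact ⟨f, hf, fun p hp => not_congr (hfs p hp)⟩

/-- If `c` is transcendental over `k`, even after inverting `d`, then almost all of the `c - a`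
with `a ∈ k` are non-units after inverting `d`. -/
theorem Polynomial.exists_ne_zero_forall_not_sub_dvd_pow {k S : Type*} [Field k] [CommRing S]
    [Algebra k S] [Algebra.FiniteType k S] (c d : S)
    (h : ∀ (p : k[X]) (n : ℕ), d ^ n * aeval c p = 0 → p = 0) :
    ∃ f : k[X], f ≠ 0 ∧ ∀ a : k, f.eval a ≠ 0 → ∀ n : ℕ, ¬ (c - algebraMap k S a) ∣ d ^ n := by
  let φ : k[X] →+* S := (aeval c : k[X] →ₐ[k] S).toRingHom
  have hφ : φ.FinitePresentation := by
    refine RingHom.FinitePresentation.of_finiteType.1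
      (RingHom.FiniteType.of_comp_finiteType (f := (C : k →+* k[X])) ?_)
    have : φ.comp C = algebraMap k S := by ext; simp [φ]
    rw [this]
    exact RingHom.finiteType_algebraMap.2 inferInstance
  -- Chevalley: the image of `D(d)` in the affine line is constructible.
  have hcons := PrimeSpectrum.isConstructible_comap_image hφ
    (PrimeSpectrum.isConstructible_basicOpen (f := d))
  obtain ⟨f, hf, hfs⟩ := PrimeSpectrum.exists_ne_zero_forall_mem_iff_bot_mem hcons
  refine ⟨f, hf, fun a ha n hn => ?_⟩
  have hbot : (⊥ : PrimeSpectrum k[X]) ∈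
      PrimeSpectrum.comap φ '' (PrimeSpectrum.basicOpen d : Set (PrimeSpectrum S)) := by
    -- By `h`, `0 ∉ M`. A prime disjoint from `M` lies in `D(d)` and over the generic point.
    let M : Submonoid S := Submonoid.powers d ⊔ (nonZeroDivisors k[X]).map φ
    obtain ⟨q, hq, -, hqM⟩ := Ideal.exists_le_prime_disjoint (⊥ : Ideal S) M (by
      rw [Set.disjoint_left]
      rintro x hx hxM
      obtain ⟨_, ⟨m, rfl⟩, _, ⟨p, hp, rfl⟩, rfl⟩ := Submonoid.mem_sup.1 hxM
      exact nonZeroDivisors.ne_zero hp (h p m hx))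
    refine ⟨⟨q, hq⟩, fun hd => Set.disjoint_left.1 hqM hd
      (Submonoid.mem_sup_left (Submonoid.mem_powers d)), ?_⟩
    ext p
    constructor
    · intro hp
      by_contra hp0
      exact Set.disjoint_left.1 hqM hp (Submonoid.mem_sup_right
        ⟨p, mem_nonZeroDivisors_of_ne_zero hp0, rfl⟩)
    · intro hp
      rw [show p = 0 from hp]
      exact zero_mem _
  have hprime : (Ideal.span {X - C a} : Ideal k[X]).IsPrime :=
    (Ideal.span_singleton_prime (X_sub_C_ne_zero a)).2 (prime_X_sub_C a)
  obtain ⟨q, hqd, hq⟩ := (hfs ⟨_, hprime⟩ (by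
    rw [Ideal.mem_span_singleton, dvd_iff_isRoot]; exact ha)).2 hbot
  have hmem : X - C a ∈ (PrimeSpectrum.comap φ q).asIdeal := by
    rw [hq]; exact Ideal.mem_span_singleton_self _
  have hmem' : c - algebraMap k S a ∈ q.asIdeal := by
    simpa [φ] using hmem
  exact hqd (q.isPrime.mem_of_pow_mem n (Ideal.mem_of_dvd _ hn hmem'))

section Constants

variable {k S : Type*} [Field k] [Differential k] [CommRing S] [Differential S] [Algebra k S]
  [DifferentialAlgebra k S]

open Polynomial in
/-- Let `S` be a differential algebra of finite type over `k` in which every nonzero constant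
divides a power of the non-nilpotent element `d`. If the field of constants of `k` is algebraically
closed, then `S` has no new constants. -/
theorem exists_constant_of_deriv_eq_zero [CharZero k] [IsAlgClosed (constantField k)]
    [Algebra.FiniteType k S] {d : S} (hd : ¬ IsNilpotent d)
    (hdvd : ∀ x : S, x′ = 0 → x ≠ 0 → ∃ n : ℕ, x ∣ d ^ n) {c : S} (hc : c′ = 0) :
    ∃ a : k, a′ = 0 ∧ algebraMap k S a = c := by
  have hconst (a : constantField k) : (algebraMap k S a)′ = 0 := by
    rw [deriv_algebraMap, show (a : k)′ = 0 from a.2, map_zero]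
  -- Otherwise some constant `a`, chosen among infinitely many, makes `c - a` a nonzero constant
  -- that divides no power of `d`.
  have hex : ∃ p : k[X], p ≠ 0 ∧ ∃ n : ℕ, d ^ n * aeval c p = 0 := by
    by_contra hcon
    push Not at hcon
    obtain ⟨f, hf, hfa⟩ := exists_ne_zero_forall_not_sub_dvd_pow (k := k) c d
      fun p n hp => by_contra fun h => hcon p h n hp
    have hinf : Set.Infinite (Set.range ((↑) : constantField k → k)) :=
      Set.infinite_range_of_injective Subtype.val_injective
    classical
    obtain ⟨_, ⟨a, rfl⟩, ha⟩ := hinf.exists_notMem_finset f.roots.toFinset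
    have ha' : f.eval (a : k) ≠ 0 := fun h => ha (by simpa [hf] using h)
    have hne : c - algebraMap k S a ≠ 0 := fun h =>
      hcon (X - C (a : k)) (X_sub_C_ne_zero _) 0 (by simp [h])
    obtain ⟨n, hn⟩ := hdvd (c - algebraMap k S a) (by rw [map_sub, hc, hconst, sub_zero]) hne
    exact hfa a ha' n hn
  classical
  let P : ℕ → Prop := fun N => ∃ p : k[X], p ≠ 0 ∧ p.natDegree = N ∧ ∃ n, d ^ n * aeval c p = 0
  have hP : ∃ N, P N := by
    obtain ⟨p, hp, h⟩ := hex
    exact ⟨_, p, hp, rfl, h⟩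
  obtain ⟨p₀, hp₀, hdeg₀, n, hn₀⟩ := Nat.find_spec hP
  have hmin (q : k[X]) (hq : q.natDegree < Nat.find hP) (m : ℕ) (hm : d ^ m * aeval c q = 0) :
      q = 0 := by
    by_contra hq0
    exact Nat.find_min hP hq ⟨q, hq0, rfl, m, hm⟩
  obtain ⟨p, hp, hdeg, hn⟩ : ∃ p : k[X], p.Monic ∧ p.natDegree = Nat.find hP ∧
      d ^ n * aeval c p = 0 := by
    refine ⟨p₀ * C p₀.leadingCoeff⁻¹, monic_mul_leadingCoeff_inv hp₀, ?_, ?_⟩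
    · rw [natDegree_mul_C (inv_ne_zero (leadingCoeff_ne_zero.2 hp₀)), hdeg₀]
    · rw [map_mul, ← mul_assoc, hn₀, zero_mul]
  have hpos : 0 < p.natDegree := by
    rw [Nat.pos_iff_ne_zero]
    intro h
    rw [hp.natDegree_eq_zero.1 h, map_one, mul_one] at hn
    exact hd ⟨n, hn⟩
  -- Differentiating the coefficients of the monic `p` lowers its degree. Differentiating the
  -- relation and multiplying by `d`, which absorbs the term with `d′`, shows that the result also
  -- annihilates `c` up to a power of `d`; minimality makes it zero.
  have hD : Differential.mapCoeffs p = 0 := by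
    refine hmin _ ?_ (n + 1) ?_
    · rw [← hdeg]
      refine lt_of_le_of_ne (natDegree_le_iff_coeff_eq_zero.2 fun N hN => ?_) fun h => ?_
      · rw [Differential.coeff_mapCoeffs, coeff_eq_zero_of_natDegree_lt hN, map_zero]
      · have h1 : (Differential.mapCoeffs p).coeff p.natDegree = 0 := by
          rw [Differential.coeff_mapCoeffs, hp.coeff_natDegree]; simp
        rw [← h] at h1
        have h2 := leadingCoeff_eq_zero.1 h1
        rw [h2, natDegree_zero] at h
        omega
    · have h1 := congrArg (fun x => d * x′) hn
      simp only [Derivation.leibniz, Derivation.leibniz_pow, Differential.deriv_aeval_eq, hc,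
        map_zero, mul_zero, add_zero, smul_eq_mul, nsmul_eq_mul] at h1
      rcases n with _ | n
      · simpa using h1
      · simp only [Nat.add_sub_cancel] at h1
        push_cast at h1
        linear_combination h1 - (n + 1 : S) * d′ * hn
  have hcoeff (i : ℕ) : (p.coeff i)′ = 0 := by
    rw [← Differential.coeff_mapCoeffs, hD, coeff_zero]
  obtain ⟨p₁, rfl⟩ : ∃ p₁ : (constantField k)[X], p₁.map (constantField k).subtype = p := by
    have hl : p ∈ lifts (constantField k).subtype := by
      rw [lifts_iff_coeff_lifts]
      exact fun i => ⟨⟨p.coeff i, hcoeff i⟩, rfl⟩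
    exact (mem_lifts p).1 hl
  obtain ⟨a, ha⟩ := IsAlgClosed.exists_root p₁ (by
    rw [natDegree_map] at hpos
    exact (natDegree_pos_iff_degree_pos.1 hpos).ne')
  refine ⟨a, a.2, ?_⟩
  -- If `c ≠ a`, the factor `c - a` divides a power of `d` and can be cancelled, leaving a relation
  -- of smaller degree.
  by_contra hca
  obtain ⟨q, rfl⟩ := dvd_iff_isRoot.2 ha
  obtain ⟨N, x, hx⟩ := hdvd (c - algebraMap k S a) (by rw [map_sub, hc, hconst, sub_zero])
    (fun h => hca (sub_eq_zero.1 h).symm)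
  have hq0 : q ≠ 0 := by
    rintro rfl
    simp at hpos
  refine hq0 ((Polynomial.map_eq_zero (constantField k).subtype).1 (hmin _ ?_ (n + N) ?_))
  · rw [← hdeg, natDegree_map, natDegree_map, natDegree_mul (X_sub_C_ne_zero _) hq0,
      natDegree_X_sub_C]
    omega
  · have : aeval c (map (constantField k).subtype ((X - C a) * q)) =
        (c - algebraMap k S a) * aeval c (map (constantField k).subtype q) := by
      simp
    rw [this] at hn
    rw [pow_add, hx]
    linear_combination x * hn

end Constants

/-! ### Nilpotents in the tensor square of a field. -/

open scoped TensorProduct in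
open Polynomial in
/-- In characteristic zero, if `a ⊗ 1 - 1 ⊗ a` is nilpotent in `K ⊗ K` then `a` lies in the
ground field. -/
theorem mem_range_algebraMap_of_isNilpotent {k K : Type*} [Field k] [CharZero k] [Field K]
    [Algebra k K] {a : K} (h : IsNilpotent (a ⊗ₜ[k] (1 : K) - (1 : K) ⊗ₜ[k] a)) :
    a ∈ Set.range (algebraMap k K) := by
  have halg : IsAlgebraic k a := by
    -- For `a` transcendental the `aⁱ ⊗ aʲ` are independent, but `aᴺ ⊗ 1` has coefficient `1` in the
    -- expansion of the `N`-th power.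
    by_contra htr
    have hli : LinearIndependent k fun i : ℕ => a ^ i := by
      have h1 := (basisMonomials k).linearIndependent.map' (aeval a).toLinearMap
        (LinearMap.ker_eq_bot.2 (transcendental_iff_injective.1 htr))
      have h2 : (fun i : ℕ => a ^ i) = (aeval a).toLinearMap ∘ basisMonomials k := by
        ext i
        simp
      rw [h2]
      exact h1
    have hli2 := hli.tmul_of_isDomain hli
    obtain ⟨N, hN⟩ := h
    rw [sub_eq_add_neg, (Commute.all _ _).add_pow'] at hN
    have h2 := linearIndependent_iff'.1 hli2 (Finset.HasAntidiagonal.antidiagonal N)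
      (fun m => (N.choose m.1 : k) * (-1) ^ m.2) (by
        rw [← hN]
        refine Finset.sum_congr rfl fun m _ => ?_
        rw [neg_pow ((1 : K) ⊗ₜ[k] a), Algebra.TensorProduct.tmul_pow,
          Algebra.TensorProduct.tmul_pow, one_pow, one_pow, mul_left_comm, Algebra.TensorProduct.tmul_mul_tmul, mul_one, one_mul,
          mul_smul, Nat.cast_smul_eq_nsmul]
        rcases Nat.even_or_odd m.2 with h | h <;> simp [h]) (N, 0) (by simp)
    simp at h2
  have heq : a ⊗ₜ[k] (1 : K) = (1 : K) ⊗ₜ[k] a := by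
    have hsep : (minpoly k a).Separable := (minpoly.irreducible halg.isIntegral).separable
    have hne : aeval a (derivative (minpoly k a)) ≠ 0 :=
      hsep.aeval_derivative_ne_zero (minpoly.aeval k a)
    let P : (K ⊗[k] K)[X] := (minpoly k a).map (algebraMap k _)
    -- Both `a ⊗ 1` and `1 ⊗ a` are roots of `P`. With `e` their difference, Taylor expansion gives
    -- `(P′(a ⊗ 1) + w e) e = 0`, and the first factor is a unit plus a nilpotent.
    obtain ⟨w, hw⟩ := P.binomExpansion (a ⊗ₜ[k] (1 : K)) ((1 : K) ⊗ₜ[k] a - a ⊗ₜ[k] (1 : K))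
    have hl (q : k[X]) : (q.map (algebraMap k (K ⊗[k] K))).eval (a ⊗ₜ[k] (1 : K)) =
        (aeval a q) ⊗ₜ 1 := by
      rw [eval_map_algebraMap]
      exact aeval_algHom_apply (Algebra.TensorProduct.includeLeft : K →ₐ[k] K ⊗[k] K) a q
    have hr (q : k[X]) : (q.map (algebraMap k (K ⊗[k] K))).eval ((1 : K) ⊗ₜ[k] a) =
        1 ⊗ₜ (aeval a q) := by
      rw [eval_map_algebraMap]
      exact aeval_algHom_apply (Algebra.TensorProduct.includeRight : K →ₐ[k] K ⊗[k] K) a q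
    have hunit : IsUnit ((aeval a (derivative (minpoly k a))) ⊗ₜ[k] (1 : K)) :=
      (IsUnit.mk0 _ hne).map (Algebra.TensorProduct.includeLeft : K →ₐ[k] K ⊗[k] K)
    rw [add_sub_cancel] at hw
    simp only [P, derivative_map, hl, hr, minpoly.aeval, TensorProduct.zero_tmul,
      TensorProduct.tmul_zero, zero_add] at hw
    have h' : IsNilpotent ((1 : K) ⊗ₜ[k] a - a ⊗ₜ[k] (1 : K)) := by
      rw [← neg_sub]; exact h.neg
    have hu2 := IsNilpotent.isUnit_add_left_of_commute ((Commute.all w _).isNilpotent_mul_left h')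
      hunit (Commute.all _ _)
    have : (aeval a (derivative (minpoly k a)) ⊗ₜ[k] (1 : K) +
      w * ((1 : K) ⊗ₜ[k] a - a ⊗ₜ[k] (1 : K))) * ((1 : K) ⊗ₜ[k] a - a ⊗ₜ[k] (1 : K)) = 0 := by
      rw [hw]; ring
    exact (sub_eq_zero.1 ((hu2.mul_right_eq_zero).1 this)).symm
  by_contra hnot
  have hli : LinearIndependent k ![a, (1 : K)] := by
    rw [LinearIndependent.pair_iff]
    intro s t hst
    have hs : s = 0 := by
      by_contra hs
      refine hnot ⟨-t / s, ?_⟩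
      have hs' : algebraMap k K s ≠ 0 := by simpa using hs
      simp only [Algebra.smul_def, mul_one] at hst
      rw [map_div₀, map_neg, div_eq_iff hs']
      linear_combination -hst
    subst hs
    simpa [Algebra.smul_def] using hst
  have hli2 := hli.tmul_of_isDomain hli
  have := hli2.injective (a₁ := (0, 1)) (a₂ := (1, 0)) (by simpa using heq)
  simp at this

/-! ### Derivations on tensor products and quotients. -/

open scoped TensorProduct

theorem Differential.deriv_algebra_smul {k R : Type*} [CommRing k] [Differential k]
    [CommRing R] [Differential R] [Algebra k R] [DifferentialAlgebra k R] (a : k) (x : R) : (a • x)′ = a • x′ + a′ • x := by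
  rw [Algebra.smul_def, Algebra.smul_def, Algebra.smul_def, Derivation.leibniz, deriv_algebraMap,
    smul_eq_mul, smul_eq_mul]
  ring

/-- The derivation `(x ⊗ y)′ = x′ ⊗ y + x ⊗ y′` on a tensor product of differential algebras. -/
noncomputable instance TensorProduct.instDifferential {k R S : Type*} [CommRing k] [Differential k]
    [CommRing R] [Differential R] [Algebra k R] [DifferentialAlgebra k R]
    [CommRing S] [Differential S] [Algebra k S] [DifferentialAlgebra k S] :
    Differential (R ⊗[k] S) where
  deriv :=
    -- The map need not be `k`-linear, since `k` has its own derivation; it is additive and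
    -- balanced.
    let f : R ⊗[k] S →+ R ⊗[k] S := TensorProduct.liftAddHom
      { toFun := fun x =>
          { toFun := fun y => x′ ⊗ₜ y + x ⊗ₜ y′
            map_zero' := by simp
            map_add' := fun y z => by simp only [map_add, TensorProduct.tmul_add]; abel }
        map_zero' := by ext y; simp
        map_add' := fun x z => by
          ext y
          simp only [map_add, TensorProduct.add_tmul, AddMonoidHom.coe_mk, ZeroHom.coe_mk,
            AddMonoidHom.add_apply]
          abel }
      (fun a x y => by
        change (a • x)′ ⊗ₜ y + (a • x) ⊗ₜ y′ = x′ ⊗ₜ (a • y) + x ⊗ₜ (a • y)′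
        simp only [Differential.deriv_algebra_smul, TensorProduct.add_tmul, TensorProduct.tmul_add,
          TensorProduct.smul_tmul]
        abel)
    Derivation.mk' f.toIntLinearMap fun a b => by
      change f (a * b) = a * f b + b * f a
      have hf (x : R) (y : S) : f (x ⊗ₜ y) = x′ ⊗ₜ y + x ⊗ₜ y′ := rfl
      induction a using TensorProduct.induction_on with
      | zero => simp
      | add a₁ a₂ h₁ h₂ => simp only [add_mul, mul_add, map_add, h₁, h₂]; abel
      | tmul x y =>
        induction b using TensorProduct.induction_on with
        | zero => simp
        | add b₁ b₂ h₁ h₂ => simp only [add_mul, mul_add, map_add, h₁, h₂]; abel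
        | tmul z w =>
          simp only [Algebra.TensorProduct.tmul_mul_tmul, hf, Derivation.leibniz, smul_eq_mul,
            TensorProduct.add_tmul, TensorProduct.tmul_add, mul_add]
          rw [mul_comm z x, mul_comm w y]
          abel

theorem TensorProduct.deriv_tmul {k R S : Type*} [CommRing k] [Differential k]
    [CommRing R] [Differential R] [Algebra k R] [DifferentialAlgebra k R]
    [CommRing S] [Differential S] [Algebra k S] [DifferentialAlgebra k S] (x : R) (y : S) :
    (x ⊗ₜ[k] y)′ = x′ ⊗ₜ y + x ⊗ₜ y′ := rfl

instance TensorProduct.instDifferentialAlgebra {k R S : Type*} [CommRing k] [Differential k]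
    [CommRing R] [Differential R] [Algebra k R] [DifferentialAlgebra k R]
    [CommRing S] [Differential S] [Algebra k S] [DifferentialAlgebra k S] :
    DifferentialAlgebra k (R ⊗[k] S) where
  deriv_algebraMap a := by
    simp [Algebra.TensorProduct.algebraMap_apply, TensorProduct.deriv_tmul, deriv_algebraMap]

/-- If `d` is not nilpotent, some differential quotient ring keeps `d` non-nilpotent and becomes
simple after inverting `d`; in particular all its nonzero constants divide powers of `d`. -/
theorem exists_differential_quotient (k : Type*) {T : Type*} [CommRing k] [Differential k]
    [CommRing T] [Differential T] [Algebra k T] [DifferentialAlgebra k T] {d : T}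
    (hd : ¬ IsNilpotent d) :
    ∃ (J : Ideal T) (_ : Differential (T ⧸ J)) (_ : DifferentialAlgebra k (T ⧸ J)),
      (∀ x : T, (Ideal.Quotient.mk J x)′ = Ideal.Quotient.mk J x′) ∧
      ¬ IsNilpotent (Ideal.Quotient.mk J d) ∧
      ∀ x : T ⧸ J, x′ = 0 → x ≠ 0 → ∃ n : ℕ, x ∣ Ideal.Quotient.mk J d ^ n := by
  obtain ⟨J, -, hJ⟩ := zorn_le_nonempty₀ {I : Ideal T | (∀ x ∈ I, x′ ∈ I) ∧ ∀ n, d ^ n ∉ I}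
    (fun c hc hchain I hI => by
      have hne : c.Nonempty := ⟨I, hI⟩
      have hmem {x : T} : x ∈ sSup c ↔ ∃ I ∈ c, x ∈ I :=
        Submodule.mem_sSup_of_directed hne hchain.directedOn
      refine ⟨sSup c, ⟨fun x hx => ?_, fun n hn => ?_⟩, fun I hI => le_sSup hI⟩
      · obtain ⟨I, hI, hxI⟩ := hmem.1 hx
        exact hmem.2 ⟨I, hI, (hc hI).1 x hxI⟩
      · obtain ⟨I, hI, hxI⟩ := hmem.1 hn
        exact (hc hI).2 n hxI) ⊥
    ⟨fun x hx => by rw [Ideal.mem_bot] at hx; simp [hx], fun n hn => hd ⟨n, hn⟩⟩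
  have hdiff : ∀ x ∈ J, x′ ∈ J := hJ.prop.1
  let D : Differential (T ⧸ J) := ⟨Derivation.liftOfSurjective
    (f := (Ideal.Quotient.mk J).toIntAlgHom) (d := Differential.deriv)
    Ideal.Quotient.mk_surjective fun x hx =>
      Ideal.Quotient.eq_zero_iff_mem.2 (hdiff x (Ideal.Quotient.eq_zero_iff_mem.1 hx))⟩
  have hD (x : T) : (Ideal.Quotient.mk J x)′ = Ideal.Quotient.mk J x′ :=
    Derivation.liftOfSurjective_apply (f := (Ideal.Quotient.mk J).toIntAlgHom)
      (d := Differential.deriv) Ideal.Quotient.mk_surjective _ x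
  refine ⟨J, D, ⟨fun a => ?_⟩, hD, ?_, ?_⟩
  · rw [← Ideal.Quotient.mk_algebraMap, hD, deriv_algebraMap, Ideal.Quotient.mk_algebraMap]
  · rintro ⟨n, hn⟩
    rw [← map_pow, Ideal.Quotient.eq_zero_iff_mem] at hn
    exact hJ.prop.2 n hn
  · intro x hx hx0
    obtain ⟨y, rfl⟩ := Ideal.Quotient.mk_surjective x
    rw [hD, Ideal.Quotient.eq_zero_iff_mem] at hx
    by_contra! hcon
    refine hx0 (Ideal.Quotient.eq_zero_iff_mem.2 ?_)
    -- As `y′ ∈ J`, the ideal `J + (y)` is differential; if it contained no power of `d`, maximality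
    -- would put `y` in `J`.
    refine hJ.le_of_ge (y := J ⊔ Ideal.span {y}) ⟨fun z hz => ?_, fun n hn => ?_⟩ le_sup_left
      (Ideal.mem_sup_right (Ideal.mem_span_singleton_self y))
    · obtain ⟨j, hj, w, hw, rfl⟩ := Submodule.mem_sup.1 hz
      obtain ⟨t, rfl⟩ := Ideal.mem_span_singleton'.1 hw
      rw [map_add, Derivation.leibniz, smul_eq_mul, smul_eq_mul]
      refine add_mem (Ideal.mem_sup_left (hdiff j hj)) (add_mem ?_ ?_)
      · exact Ideal.mem_sup_left (Ideal.mul_mem_left _ _ hx)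
      · exact Ideal.mem_sup_right (Ideal.mul_mem_right _ _ (Ideal.mem_span_singleton_self y))
    · obtain ⟨j, hj, w, hw, hjw⟩ := Submodule.mem_sup.1 hn
      obtain ⟨t, rfl⟩ := Ideal.mem_span_singleton'.1 hw
      refine hcon n ⟨Ideal.Quotient.mk J t, ?_⟩
      rw [← map_pow, ← hjw, map_add, Ideal.Quotient.eq_zero_iff_mem.2 hj, zero_add, map_mul,
        mul_comm]

/-! ### Constants of a Picard–Vessiot field. -/

namespace IsPicardVessiotRing

variable {k R : Type*} [Field k] [Differential k] {n : ℕ} {A : Matrix (Fin n) (Fin n) k}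
  [CommRing R] [Differential R] [Algebra k R] [DifferentialAlgebra k R]

theorem finiteType (hR : IsPicardVessiotRing A R) : Algebra.FiniteType k R := by
  obtain ⟨Z, -, hZ⟩ := hR.exists_fundamental
  refine ⟨Subalgebra.fg_def.2 ⟨_, ?_, hZ⟩⟩
  exact (Set.finite_range _).insert _

/-- The ideal generated by a constant is differential. -/
theorem dvd_one_of_deriv_eq_zero (hR : IsPicardVessiotRing A R) {x : R} (hx : x′ = 0)
    (hx0 : x ≠ 0) : x ∣ 1 := by
  rcases hR.simple (Ideal.span {x}) (fun y hy => by
    obtain ⟨t, rfl⟩ := Ideal.mem_span_singleton'.1 hy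
    rw [Derivation.leibniz, hx, smul_zero, zero_add, smul_eq_mul]
    exact Ideal.mul_mem_right _ _ (Ideal.mem_span_singleton_self x)) with h | h
  · exact absurd (Ideal.span_singleton_eq_bot.1 h) hx0
  · exact isUnit_iff_dvd_one.1 (Ideal.span_singleton_eq_top.1 h)

variable [CharZero k] [IsAlgClosed (constantField k)]

/-- A Picard-Vessiot field has no new constants. -/
theorem exists_constant (hR : IsPicardVessiotRing A R) {K : Type*} [Field K] [Differential K]
    [Algebra k K] [Algebra R K] [DifferentialAlgebra R K] [IsScalarTower k R K]
    [IsFractionRing R K] {c : K} (hc : c′ = 0) : ∃ a : k, a′ = 0 ∧ algebraMap k K a = c := by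
  have := hR.nontrivial
  have := hR.finiteType
  -- The ideal of denominators of `c` is nonzero, and differential because `c′ = 0`; simplicity then
  -- gives `1 ∈ I`, so `c` comes from `R`.
  let I : Ideal R :=
    { carrier := {r | ∃ s : R, algebraMap R K r * c = algebraMap R K s}
      zero_mem' := ⟨0, by simp⟩
      add_mem' := by
        rintro x y ⟨s, hs⟩ ⟨t, ht⟩
        exact ⟨s + t, by rw [map_add, map_add, add_mul, hs, ht]⟩
      smul_mem' := by
        rintro r x ⟨s, hs⟩
        exact ⟨r * s, by rw [smul_eq_mul, map_mul, map_mul, mul_assoc, hs]⟩ }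
  obtain ⟨r, rfl⟩ : ∃ r : R, algebraMap R K r = c := by
    rcases hR.simple I (fun x ⟨s, hs⟩ => ⟨s′, by
      rw [← deriv_algebraMap s, ← hs, Derivation.leibniz, hc, smul_zero, zero_add, smul_eq_mul,
        deriv_algebraMap, mul_comm]⟩) with h | h
    · obtain ⟨x, y, hy, rfl⟩ := IsFractionRing.div_surjective (A := R) c
      have hyI : y ∈ I := ⟨x, mul_div_cancel₀ _
        (IsFractionRing.to_map_ne_zero_of_mem_nonZeroDivisors hy)⟩
      rw [h, Ideal.mem_bot] at hyI
      exact absurd hyI (nonZeroDivisors.ne_zero hy)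
    · obtain ⟨s, hs⟩ : (1 : R) ∈ I := h ▸ Submodule.mem_top
      exact ⟨s, by rw [← hs, map_one, one_mul]⟩
  rw [deriv_algebraMap, ← map_zero (algebraMap R K)] at hc
  obtain ⟨a, ha, rfl⟩ := exists_constant_of_deriv_eq_zero (k := k) (d := (1 : R))
    (fun ⟨n, h⟩ => by simp at h)
    (fun x hx hx0 => ⟨0, by simpa using hR.dvd_one_of_deriv_eq_zero hx hx0⟩)
    (IsFractionRing.injective R K hc)
  exact ⟨a, ha, IsScalarTower.algebraMap_apply k R K a⟩

end IsPicardVessiotRing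

/-! ### Fundamental matrices, automorphisms and the fixed field. -/

namespace Matrix

variable {R : Type*} [CommRing R] [Differential R] {l m n : Type*} [Fintype m]

theorem map_deriv_mul (P : Matrix l m R) (Q : Matrix m n R) :
    (P * Q).map (fun x => x′) = P.map (fun x => x′) * Q + P * Q.map (fun x => x′) := by
  ext i j
  simp only [map_apply, add_apply, mul_apply, map_sum, Derivation.leibniz, smul_eq_mul,
    ← Finset.sum_add_distrib]
  exact Finset.sum_congr rfl fun x _ => by ring

theorem map_deriv_inv [DecidableEq m] {A Z W : Matrix m m R} (hZ : Z.map (fun x => x′) = A * Z)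
    (hZW : Z * W = 1) : W.map (fun x => x′) = -(W * A) := by
  have hWZ : W * Z = 1 := mul_eq_one_comm.1 hZW
  have h : (W * Z).map (fun x => x′) = 0 := by
    rw [hWZ]
    ext i j
    by_cases hij : i = j <;> simp [hij]
  rw [map_deriv_mul, hZ] at h
  calc W.map (fun x => x′) = W.map (fun x => x′) * (Z * W) := by rw [hZW, mul_one]
    _ = (W.map (fun x => x′) * Z + W * (A * Z)) * W - W * A * (Z * W) := by noncomm_ring
    _ = -(W * A) := by rw [h, hZW, zero_mul, mul_one, zero_sub]

end Matrix

namespace IsPicardVessiotRing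

variable {k R : Type*} [Field k] [Differential k] {n : ℕ} {A : Matrix (Fin n) (Fin n) k}
  [CommRing R] [Differential R] [Algebra k R] [DifferentialAlgebra k R]

/-- Two differential homomorphisms from a Picard-Vessiot ring to a differential ring without new
constants have the same range. -/
theorem range_le_range (hR : IsPicardVessiotRing A R) {S : Type*} [CommRing S] [Differential S]
    [Algebra k S] [DifferentialAlgebra k S]
    (hS : ∀ c : S, c′ = 0 → c ∈ Set.range (algebraMap k S))
    (φ ψ : R →ₐ[k] S) (hφ : ∀ x, φ x′ = (φ x)′) (hψ : ∀ x, ψ x′ = (ψ x)′) :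
    φ.range ≤ ψ.range := by
  obtain ⟨Z, hZ, hadj⟩ := hR.exists_fundamental
  let Zm : Matrix (Fin n) (Fin n) R := Z
  let W : Matrix (Fin n) (Fin n) R := (Z⁻¹ : GL (Fin n) R)
  have hZW : Zm * W = 1 := by simp only [Zm, W, ← Units.val_mul, mul_inv_cancel, Units.val_one]
  have hWZ : W * Zm = 1 := mul_eq_one_comm.1 hZW
  have hmap (θ : R →ₐ[k] S) (hθ : ∀ x, θ x′ = (θ x)′) :
      (Zm.map θ).map (fun x => x′) = A.map (algebraMap k S) * Zm.map θ := by
    have h := congrArg (fun M => Matrix.map M θ) hZ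
    have hA : (A.map (algebraMap k R)).map θ = A.map (algebraMap k S) := by
      ext i j; simp
    rw [← hA]
    refine Eq.trans ?_ (h.trans (Matrix.map_mul (f := (θ : R →+* S))))
    ext i j
    simp [Zm, hθ]
  have hinv (θ : R →ₐ[k] S) : Zm.map θ * W.map θ = 1 := by
    have h := congrArg (fun M => Matrix.map M θ) hZW
    refine (Matrix.map_mul (f := (θ : R →+* S))).symm.trans (h.trans ?_)
    exact Matrix.map_one θ (map_zero θ) (map_one θ)
  -- Two fundamental matrices of the same system differ by a constant matrix on the right.
  have hconst (θ η : R →ₐ[k] S) (hθ : ∀ x, θ x′ = (θ x)′) (hη : ∀ x, η x′ = (η x)′) (i j) :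
      (W.map θ * Zm.map η) i j ∈ Set.range (algebraMap k S) := by
    refine hS _ ?_
    have h : (W.map θ * Zm.map η).map (fun x => x′) = 0 := by
      rw [Matrix.map_deriv_mul, hmap η hη, Matrix.map_deriv_inv (hmap θ hθ) (hinv θ)]
      noncomm_ring
    exact congrFun (congrFun h i) j
  have hrange (x : S) (hx : x ∈ Set.range (algebraMap k S)) : x ∈ ψ.range := by
    obtain ⟨a, rfl⟩ := hx
    exact ψ.range.algebraMap_mem a
  rw [← Algebra.map_top, ← hadj, AlgHom.map_adjoin, Algebra.adjoin_le_iff]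
  rintro _ ⟨x, rfl | ⟨⟨i, j⟩, rfl⟩, rfl⟩
  · have h1 : ((Matrix.GeneralLinearGroup.det Z)⁻¹ : Rˣ).val = W.det := by
      rw [← map_inv]; rfl
    have h2 : W.map φ = (W.map φ * Zm.map ψ) * W.map ψ := by
      rw [mul_assoc, hinv, mul_one]
    have h3 (θ : R →ₐ[k] S) : θ W.det = (W.map θ).det := AlgHom.map_det θ W
    rw [h1]
    change φ W.det ∈ ψ.range
    rw [h3, h2, Matrix.det_mul, ← h3]
    refine mul_mem ?_ ⟨_, rfl⟩
    rw [Matrix.det_apply]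
    exact sum_mem fun σ _ => Subalgebra.zsmul_mem _ (prod_mem fun i _ =>
      hrange _ (hconst φ ψ hφ hψ _ _)) _
  · have h2 : Zm.map φ = Zm.map ψ * (W.map ψ * Zm.map φ) := by
      rw [← mul_assoc, hinv, one_mul]
    change Zm.map φ i j ∈ ψ.range
    rw [h2, Matrix.mul_apply]
    exact sum_mem fun l _ => mul_mem ⟨Zm i l, rfl⟩ (hrange _ (hconst ψ φ hψ hφ _ _))

/-- The kernel is a proper differential ideal. -/
theorem injective_of_deriv (hR : IsPicardVessiotRing A R) {S : Type*} [CommRing S] [Nontrivial S]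
    [Differential S] [Algebra k S] (φ : R →ₐ[k] S) (hφ : ∀ x, φ x′ = (φ x)′) :
    Function.Injective φ := by
  rw [← RingHom.coe_coe, RingHom.injective_iff_ker_eq_bot]
  refine (hR.simple _ fun x hx => ?_).resolve_right (RingHom.ker_ne_top _)
  rw [RingHom.mem_ker, RingHom.coe_coe] at hx ⊢
  rw [hφ, hx, map_zero]

/-- Both maps are injective with the same range, so `σ` is `ψ⁻¹ ∘ φ`. -/
theorem exists_algEquiv (hR : IsPicardVessiotRing A R) {S : Type*} [CommRing S] [Nontrivial S]
    [Differential S] [Algebra k S] [DifferentialAlgebra k S]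
    (hS : ∀ c : S, c′ = 0 → c ∈ Set.range (algebraMap k S))
    (φ ψ : R →ₐ[k] S) (hφ : ∀ x, φ x′ = (φ x)′) (hψ : ∀ x, ψ x′ = (ψ x)′) :
    ∃ σ : R ≃ₐ[k] R, (∀ x, σ x′ = (σ x)′) ∧ ∀ x, ψ (σ x) = φ x := by
  have hle := hR.range_le_range hS φ ψ hφ hψ
  have hge := hR.range_le_range hS ψ φ hψ hφ
  have hφi := hR.injective_of_deriv φ hφ
  have hψi := hR.injective_of_deriv ψ hψ
  let σ : R ≃ₐ[k] R := (AlgEquiv.ofInjective φ hφi).trans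
    ((Subalgebra.equivOfEq _ _ (le_antisymm hle hge)).trans (AlgEquiv.ofInjective ψ hψi).symm)
  have hσ (x : R) : ψ (σ x) = φ x := by
    have h := (AlgEquiv.ofInjective ψ hψi).apply_symm_apply
      (Subalgebra.equivOfEq _ _ (le_antisymm hle hge) (AlgEquiv.ofInjective φ hφi x))
    exact congrArg Subtype.val h
  exact ⟨σ, fun x => hψi (by rw [hσ, hφ, hψ, hσ]), hσ⟩

variable [CharZero k] [IsAlgClosed (constantField k)]

/-- The elements of a Picard-Vessiot field fixed by the differential Galois group lie in the base
field. -/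
theorem mem_range_of_forall_DGal (hR : IsPicardVessiotRing A R) {K : Type*} [Field K]
    [Differential K] [Algebra k K] [Algebra R K] [DifferentialAlgebra R K] [IsScalarTower k R K]
    [IsFractionRing R K] {a : K} (ha : ∀ σ ∈ DGal k K, σ a = a) :
    a ∈ Set.range (algebraMap k K) := by
  have := hR.nontrivial
  have := hR.finiteType
  obtain ⟨b, c, hc, rfl⟩ := IsFractionRing.div_surjective (A := R) a
  have hc0 := IsFractionRing.to_map_ne_zero_of_mem_nonZeroDivisors (K := K) hc
  by_cases hd : IsNilpotent (b ⊗ₜ[k] c - c ⊗ₜ[k] b)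
  -- Multiplying by `c⁻¹ ⊗ c⁻¹` in `K ⊗ K` turns the nilpotent into `a ⊗ 1 - 1 ⊗ a`.
  · refine mem_range_algebraMap_of_isNilpotent ?_
    let ι : R →ₐ[k] K := IsScalarTower.toAlgHom k R K
    have h1 := (hd.map (Algebra.TensorProduct.map ι ι))
    have h2 := (Commute.all ((ι c)⁻¹ ⊗ₜ[k] (ι c)⁻¹) _).isNilpotent_mul_left h1
    have hιc : ι c ≠ 0 := hc0
    rw [map_sub, Algebra.TensorProduct.map_tmul, Algebra.TensorProduct.map_tmul, mul_sub,
      Algebra.TensorProduct.tmul_mul_tmul, Algebra.TensorProduct.tmul_mul_tmul,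
      inv_mul_cancel₀ hιc] at h2
    rw [div_eq_inv_mul]
    exact h2
  · exfalso
    obtain ⟨J, D, hDA, hJ, hnil, hdvd⟩ := exists_differential_quotient k hd
    have : Algebra.FiniteType k (R ⊗[k] R) :=
      Algebra.FiniteType.trans (S := R) inferInstance inferInstance
    have : Nontrivial ((R ⊗[k] R) ⧸ J) := by
      by_contra hn
      rw [not_nontrivial_iff_subsingleton] at hn
      exact hnil ⟨1, Subsingleton.elim _ _⟩
    let π : R ⊗[k] R →ₐ[k] (R ⊗[k] R) ⧸ J := Ideal.Quotient.mkₐ k J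
    have hπ (x : R ⊗[k] R) : π x′ = (π x)′ := (hJ x).symm
    obtain ⟨σ, hσ, hσφ⟩ := hR.exists_algEquiv
      (fun x hx => by
        obtain ⟨a, -, h⟩ := exists_constant_of_deriv_eq_zero (k := k) hnil hdvd hx
        exact ⟨a, h⟩)
      (π.comp Algebra.TensorProduct.includeLeft) (π.comp Algebra.TensorProduct.includeRight)
      (fun x => by
        simp only [AlgHom.comp_apply, ← hπ, Algebra.TensorProduct.includeLeft_apply,
          TensorProduct.deriv_tmul, Derivation.map_one_eq_zero, TensorProduct.tmul_zero, add_zero])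
      (fun x => by
        simp only [AlgHom.comp_apply, ← hπ, Algebra.TensorProduct.includeRight_apply,
          TensorProduct.deriv_tmul, Derivation.map_one_eq_zero, TensorProduct.zero_tmul, zero_add])
    let τ : K ≃ₐ[k] K := IsFractionRing.algEquivOfAlgEquiv σ
    have hτR (x : R) : τ (algebraMap R K x) = algebraMap R K (σ x) :=
      IsFractionRing.algEquivOfAlgEquiv_algebraMap σ x
    have hτ : τ ∈ DGal k K := by
      intro x
      obtain ⟨y, z, hz, rfl⟩ := IsFractionRing.div_surjective (A := R) x
      have hz0 := IsFractionRing.to_map_ne_zero_of_mem_nonZeroDivisors (K := K) hz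
      simp only [Derivation.leibniz_div, map_div₀, map_inv₀, map_sub, map_mul, smul_eq_mul,
        map_pow, hτR, deriv_algebraMap, hσ]
    have h := ha τ hτ
    have hσc : algebraMap R K (σ c) ≠ 0 := by rw [← hτR]; simpa using hc0
    rw [map_div₀, hτR, hτR, div_eq_div_iff hσc hc0, ← map_mul, ← map_mul] at h
    have h' := IsFractionRing.injective R K h
    refine hnil ⟨1, ?_⟩
    -- Thus `π` sends `b ⊗ c - c ⊗ b` to the image of `σ b * c - σ c * b`, which vanishes if `τ`
    -- fixes `b / c`.
    have h3 : ∀ x y : R, π (x ⊗ₜ[k] y) =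
        π.comp Algebra.TensorProduct.includeRight (σ x * y) := by
      intro x y
      rw [map_mul, hσφ, AlgHom.comp_apply, AlgHom.comp_apply, ← map_mul]
      simp
    rw [pow_one]
    change π _ = 0
    rw [map_sub, h3, h3, h', mul_comm b, sub_self]

end IsPicardVessiotRing

/-! ### Actions of operators and right division by `∂ - u`. -/

namespace DiffOp

variable {k : Type*} [Field k]

/-- The action of an operator on a `k`-algebra on which `∂` acts as `δ`. -/
noncomputable def act {M : Type*} [CommRing M] [Algebra k M] (δ : M →+ M) (L : DiffOp k) (y : M) :
    M :=
  L.toPoly.sum fun i a => algebraMap k M a * δ^[i] y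

section act

variable {M : Type*} [CommRing M] [Algebra k M] (δ : M →+ M)

theorem act_add_left (L N : DiffOp k) (y : M) : act δ (L + N) y = act δ L y + act δ N y :=
  Polynomial.sum_add_index L.toPoly N.toPoly _ (by simp) (by intros; simp [add_mul])

theorem act_monomial (i : ℕ) (a : k) (y : M) :
    act δ (ofPoly (Polynomial.monomial i a)) y = algebraMap k M a * δ^[i] y :=
  Polynomial.sum_monomial_index _ _ (by simp)

theorem act_zero_right (L : DiffOp k) : act δ L 0 = 0 := by
  simp [act, Polynomial.sum]

theorem act_const (a : k) (y : M) : act δ (const a) y = algebraMap k M a * y :=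
  act_monomial δ 0 a y

theorem act_partialOp (y : M) : act δ (partialOp : DiffOp k) y = δ y := by
  have h := act_monomial (k := k) δ 1 1 y
  rw [Polynomial.monomial_one_one_eq_X, map_one, one_mul] at h
  exact h

theorem act_sub_left (L N : DiffOp k) (y : M) : act δ (L - N) y = act δ L y - act δ N y := by
  rw [eq_sub_iff_add_eq, ← act_add_left, sub_add_cancel]

variable [Differential k]

variable (hδ : ∀ (a : k) (y : M), δ (algebraMap k M a * y) =
  algebraMap k M a′ * y + algebraMap k M a * δ y)

include hδ in
theorem act_partialMul (N : k[X]) (y : M) :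
    act δ (ofPoly (partialMul N)) y = δ (act δ (ofPoly N) y) := by
  induction N using Polynomial.induction_on' with
  | add p q hp hq =>
    rw [partialMul_add]
    refine (act_add_left δ (ofPoly (partialMul p)) (ofPoly (partialMul q)) y).trans ?_
    rw [hp, hq, ← map_add]
    exact congrArg δ (act_add_left δ (ofPoly p) (ofPoly q) y).symm
  | monomial i b =>
    have h : partialMul (Polynomial.monomial i b) =
        Polynomial.monomial i b′ + Polynomial.monomial (i + 1) b := by
      simp [partialMul, Polynomial.X_mul_monomial]
    rw [h, act_monomial, hδ, ← Function.iterate_succ_apply' δ, ← act_monomial, ← act_monomial]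
    exact act_add_left δ _ _ y

-- Only compatibility with `∂ a = a′ + a ∂` is needed, so `δ` need not be a derivation: the lemma
-- serves both the derivation of `K` and `twist u` on `k`.
include hδ in
theorem act_mul (L N : DiffOp k) (y : M) : act δ (L * N) y = act δ L (act δ N y) := by
  change act δ (ofPoly (mulPoly L.toPoly N.toPoly)) y = act δ (ofPoly L.toPoly) (act δ N y)
  generalize L.toPoly = p
  induction p using Polynomial.induction_on' with
  | add p q hp hq =>
    rw [mulPoly_add_left]
    refine (act_add_left δ (ofPoly (mulPoly p N.toPoly)) (ofPoly (mulPoly q N.toPoly)) y).trans ?_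
    rw [hp, hq]
    exact (act_add_left δ (ofPoly p) (ofPoly q) _).symm
  | monomial i a =>
    rw [mulPoly_monomial, act_monomial]
    have hC (q : k[X]) : act δ (ofPoly (Polynomial.C a * q)) y =
        algebraMap k M a * act δ (ofPoly q) y := by
      induction q using Polynomial.induction_on' with
      | add p q hp hq =>
        rw [mul_add]
        refine (act_add_left δ (ofPoly (Polynomial.C a * p)) (ofPoly (Polynomial.C a * q)) y).trans
          ?_
        rw [hp, hq, ← mul_add]
        exact congrArg _ (act_add_left δ (ofPoly p) (ofPoly q) y).symm
      | monomial i b =>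
        rw [Polynomial.C_mul_monomial, act_monomial, act_monomial, map_mul, mul_assoc]
    rw [hC]
    congr 1
    induction i with
    | zero => rfl
    | succ i ih => rw [Function.iterate_succ_apply', act_partialMul δ hδ, ih,
        Function.iterate_succ_apply']

end act

variable [Differential k]

/-- Right division by `∂ - u` with remainder. -/
theorem exists_eq_mul_partialOp_sub_add (u : k) (L : DiffOp k) :
    ∃ (Q : DiffOp k) (r : k), L = Q * (partialOp - const u) + const r := by
  have hadd (a b : k) : (const (a + b) : DiffOp k) = const a + const b :=
    congrArg ofPoly (Polynomial.C_add (a := a) (b := b))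
  have hmul (a b : k) : (const (a * b) : DiffOp k) = const a * const b := by
    change Polynomial.C (a * b) = mulPoly (Polynomial.monomial 0 a) (Polynomial.C b)
    rw [mulPoly_monomial, Function.iterate_zero, id, Polynomial.C_mul]
  change ∃ (Q : DiffOp k) (r : k), ofPoly L.toPoly = Q * (partialOp - const u) + const r
  generalize L.toPoly = p
  induction p using Polynomial.induction_on' with
  | add p q hp hq =>
    obtain ⟨Q, r, h⟩ := hp
    obtain ⟨Q', r', h'⟩ := hq
    refine ⟨Q + Q', r + r', ?_⟩
    change ofPoly p + ofPoly q = _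
    rw [h, h', hadd]
    noncomm_ring
  | monomial i a =>
    have hi : ∃ (Q : DiffOp k) (r : k), partialOp ^ i = Q * (partialOp - const u) + const r := by
      induction i with
      | zero => exact ⟨0, 1, by rw [zero_mul, zero_add, pow_zero]; rfl⟩
      | succ i ih =>
        obtain ⟨Q, r, h⟩ := ih
        -- From `∂ r = r ∂ + r′ = r (∂ - u) + (r′ + r u)`.
        refine ⟨partialOp * Q + const r, r′ + r * u, ?_⟩
        rw [pow_succ', h, mul_add, partialOp_mul_const, hadd, hmul]
        noncomm_ring
    have hp (i : ℕ) : (ofPoly (Polynomial.monomial i a) : DiffOp k) = const a * partialOp ^ i := by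
      have hX : (partialOp ^ i : DiffOp k) = ofPoly (Polynomial.X ^ i) := by
        induction i with
        | zero => rfl
        | succ i ih =>
          rw [pow_succ', ih]
          change mulPoly Polynomial.X _ = _
          rw [← Polynomial.monomial_one_one_eq_X, mulPoly_monomial]
          change _ * partialMul^[1] (Polynomial.X ^ i) = Polynomial.X ^ (i + 1)
          rw [← partialMul_iterate_one, ← Function.iterate_add_apply, partialMul_iterate_one,
            Polynomial.C_1, one_mul, add_comm]
      rw [hX]
      change Polynomial.monomial i a = mulPoly (Polynomial.monomial 0 a) (Polynomial.X ^ i)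
      rw [mulPoly_monomial, Function.iterate_zero, id, Polynomial.C_mul_X_pow_eq_monomial]
    obtain ⟨Q, r, h⟩ := hi
    exact ⟨const a * Q, a * r, by rw [hp, h, hmul]; noncomm_ring⟩

end DiffOp

namespace DiffOp

variable {k : Type*} [Field k]

theorem eval_eq_act {K : Type*} [Field K] [Differential K] [Algebra k K] (L : DiffOp k) (y : K) :
    L.eval y = act (Differential.deriv : Derivation ℤ K K).toLinearMap.toAddMonoidHom L y := rfl

variable [Differential k]

theorem eval_mul {K : Type*} [Field K] [Differential K] [Algebra k K] [DifferentialAlgebra k K]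
    (L N : DiffOp k) (y : K) : (L * N).eval y = L.eval (N.eval y) := by
  simp only [eval_eq_act]
  refine act_mul _ (fun a y => ?_) L N y
  change (algebraMap k K a * y)′ = algebraMap k K a′ * y + algebraMap k K a * (y′)
  rw [Derivation.leibniz, deriv_algebraMap, smul_eq_mul, smul_eq_mul]
  ring

theorem eval_partialOp_sub_const {K : Type*} [Field K] [Differential K] [Algebra k K] (u : k)
    (y : K) : (partialOp - const u : DiffOp k).eval y = y′ - algebraMap k K u * y := by
  rw [eval_eq_act, act_sub_left, act_partialOp, act_const]
  rfl

theorem eval_eq_zero_of_isRightDivisor {K : Type*} [Field K] [Differential K] [Algebra k K]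
    [DifferentialAlgebra k K] {u : k} {L : DiffOp k}
    (h : IsRightDivisor (partialOp - const u) L) {z : K} (hz : z′ = algebraMap k K u * z) :
    L.eval z = 0 := by
  obtain ⟨Q, rfl⟩ := h
  rw [eval_mul, eval_partialOp_sub_const, hz, sub_self, eval_eq_act, act_zero_right]

/-- Applying `L = Q (∂ - u) + r` to `z` leaves `r z = 0`. -/
theorem isRightDivisor_of_eval_eq_zero {K : Type*} [Field K] [Differential K] [Algebra k K]
    [DifferentialAlgebra k K] {u : k} {L : DiffOp k} {z : K} (hz0 : z ≠ 0)
    (hz : z′ = algebraMap k K u * z) (hL : L.eval z = 0) :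
    IsRightDivisor (partialOp - const u) L := by
  obtain ⟨Q, r, rfl⟩ := exists_eq_mul_partialOp_sub_add u L
  have hQ : (Q * (partialOp - const u)).eval z = 0 := eval_eq_zero_of_isRightDivisor ⟨Q, rfl⟩ hz
  rw [eval_eq_act, act_add_left, ← eval_eq_act, hQ, zero_add, act_const] at hL
  have hr : r = 0 := by simpa [hz0] using hL
  refine ⟨Q, ?_⟩
  rw [hr]
  exact (congrArg _ (congrArg ofPoly Polynomial.C_0)).trans (add_zero _)

/-- The action of `∂` on coefficients of a solution of `y′ = u y`: `(a y)′ = (a′ + u a) y`. -/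
def twist (u : k) : k →+ k :=
  (Differential.deriv : Derivation ℤ k k).toLinearMap.toAddMonoidHom + AddMonoidHom.mulLeft u

theorem twist_apply (u a : k) : twist u a = a′ + u * a := rfl

/-- For a formal solution `y` of `y′ = u y`, `(twist u)^[i] 1` is `y⁽ⁱ⁾ / y`, so this is `L(y) / y =
0` computed inside `k`. It holds because `∂ - u` kills `1` in the twisted action. -/
theorem sum_coeff_mul_twist_eq_zero {u : k} {L : DiffOp k}
    (h : IsRightDivisor (partialOp - const u) L) :
    ∑ i ∈ Finset.range (L.order + 1), L.toPoly.coeff i * (twist u)^[i] 1 = 0 := by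
  have h1 : act (twist u) L 1 = 0 := by
    obtain ⟨Q, rfl⟩ := h
    rw [act_mul, act_sub_left, act_partialOp, act_const, twist_apply]
    · simp [act_zero_right]
    · intro a y
      simp only [twist_apply, Algebra.algebraMap_self, RingHom.id_apply, Derivation.leibniz,
        smul_eq_mul]
      ring
  rw [← h1, act, Polynomial.sum_over_range _ (by simp)]
  rfl

theorem order_pos_of_isRightDivisor {u : k} {L : DiffOp k} (hL : L ≠ 0)
    (h : IsRightDivisor (partialOp - const u) L) : 0 < L.order := by
  rw [Nat.pos_iff_ne_zero]
  intro h0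
  have h1 := sum_coeff_mul_twist_eq_zero h
  have h2 : L.toPoly.coeff L.order ≠ 0 := Polynomial.leadingCoeff_ne_zero.2 hL
  rw [h0] at h1 h2
  simp at h1
  exact h2 h1

/-- The last row is the relation `L(y) / y = 0` solved for its top term; the other rows only shift.
-/
theorem sum_companion_mul_twist {u : k} {L : DiffOp k} (hL : L ≠ 0)
    (h : IsRightDivisor (partialOp - const u) L) (i : Fin L.order) :
    ∑ j, L.companion i j * (twist u)^[j] 1 = (twist u)^[i + 1] 1 := by
  by_cases hi : (i : ℕ) + 1 = L.order
  · have hlc : L.toPoly.leadingCoeff ≠ 0 := Polynomial.leadingCoeff_ne_zero.2 hL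
    have h1 := sum_coeff_mul_twist_eq_zero h
    rw [Finset.sum_range_succ, ← Fin.sum_univ_eq_sum_range
      (fun j => L.toPoly.coeff j * (twist u)^[j] 1)] at h1
    simp only [companion, Matrix.of_apply, if_pos hi]
    rw [hi]
    have h2 : L.toPoly.coeff L.order = L.toPoly.leadingCoeff := rfl
    rw [h2] at h1
    have h3 : ∑ j : Fin L.order, -L.toPoly.coeff j / L.toPoly.leadingCoeff * (twist u)^[j] 1 =
        -(∑ j : Fin L.order, L.toPoly.coeff j * (twist u)^[j] 1) / L.toPoly.leadingCoeff := by
      rw [← Finset.sum_neg_distrib, Finset.sum_div]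
      exact Finset.sum_congr rfl fun j _ => by ring
    rw [h3, div_eq_iff hlc]
    linear_combination -h1
  · have hlt : (i : ℕ) + 1 < L.order := lt_of_le_of_ne i.2 hi
    rw [Finset.sum_eq_single ⟨i + 1, hlt⟩]
    · simp [companion, hi]
    · intro j _ hj
      have hj' : (j : ℕ) ≠ i + 1 := fun h => hj (Fin.ext h)
      simp [companion, hi, hj']
    · simp

end DiffOp

/-! ### Solutions coming from right divisors of order one. -/

namespace IsPicardVessiotRing

variable {k R : Type*} [Field k] [Differential k] [CommRing R] [Differential R] [Algebra k R]
  [DifferentialAlgebra k R]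

/-- If `∂ - u` is a right divisor of `L`, then a Picard-Vessiot ring for `L` contains a nonzero
solution of `f′ = -u f`. -/
theorem exists_deriv_eq_neg {L : DiffOp k} (hL : L ≠ 0) (hR : IsPicardVessiotRing L.companion R)
    {u : k} (h : DiffOp.IsRightDivisor (DiffOp.partialOp - DiffOp.const u) L) :
    ∃ f : R, f ≠ 0 ∧ f′ = -(algebraMap k R u * f) := by
  have := hR.nontrivial
  obtain ⟨Z, hZ, -⟩ := hR.exists_fundamental
  let W : Matrix (Fin L.order) (Fin L.order) R := (Z⁻¹ : GL (Fin L.order) R)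
  have hZW : (Z : Matrix (Fin L.order) (Fin L.order) R) * W = 1 := by
    simp only [W, ← Units.val_mul, mul_inv_cancel, Units.val_one]
  let E : Matrix (Fin L.order) Unit R :=
    Matrix.of fun i _ => algebraMap k R ((DiffOp.twist u)^[i] 1)
  have hE : E.map (fun x => x′) = L.companion.map (algebraMap k R) * E - algebraMap k R u • E := by
    ext i j
    simp only [E, Matrix.map_apply, Matrix.of_apply, Matrix.sub_apply, Matrix.smul_apply,
      Matrix.mul_apply, ← map_mul, ← map_sum, smul_eq_mul, DiffOp.sum_companion_mul_twist hL h,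
      deriv_algebraMap, ← map_sub]
    rw [Function.iterate_succ_apply', DiffOp.twist_apply, add_sub_cancel_right]
  -- Since `W′ = -W A_L`, the companion terms cancel.
  have hF : (W * E).map (fun x => x′) = -(algebraMap k R u • (W * E)) := by
    rw [Matrix.map_deriv_mul, hE, Matrix.map_deriv_inv hZ hZW, Matrix.mul_sub, ← Matrix.mul_assoc,
      Matrix.mul_smul, Matrix.neg_mul]
    abel
  have hne : W * E ≠ 0 := by
    intro h0
    have h1 : E = 0 := by
      rw [← Matrix.one_mul E, ← hZW, Matrix.mul_assoc, h0, Matrix.mul_zero]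
    -- The top entry of `E` is `1`; it exists because the order is positive.
    have h2 := congrFun (congrFun h1 ⟨0, DiffOp.order_pos_of_isRightDivisor hL h⟩) ()
    simp [E] at h2
  obtain ⟨i, hi⟩ : ∃ i, (W * E) i () ≠ 0 := by
    by_contra! hcon
    exact hne (by ext i j; exact hcon i)
  exact ⟨(W * E) i (), hi, congrFun (congrFun hF i) ()⟩

end IsPicardVessiotRing

/-! ### Invariant lines and logarithmic derivatives. -/

section Line

variable {k K : Type*} [Field k] [Differential k] [Field K] [Differential K] [Algebra k K]
  [DifferentialAlgebra k K]

/-- As `σ` commutes with the derivation, `σ (z′ / z)` is the logarithmic derivative of `σ z`; it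
equals that of `z` exactly when `σ z / z` is constant, and `hK` makes such a constant a scalar. -/
theorem spansInvariantLine_iff (hK : ∀ c : K, c′ = 0 → ∃ a : k, a′ = 0 ∧ algebraMap k K a = c)
    {z : K} (hz : z ≠ 0) :
    SpansInvariantLine k z ↔ ∀ σ ∈ DGal k K, σ (z′ / z) = z′ / z := by
  have hconst (a : constantField k) : (algebraMap k K a)′ = 0 := by
    rw [deriv_algebraMap, show (a : k)′ = 0 from a.2, map_zero]
  have hsmul (a : constantField k) (w : K) : a • w = algebraMap k K a * w :=
    Algebra.smul_def (a : k) w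
  constructor
  · rintro ⟨-, h⟩ σ hσ
    obtain ⟨c, hc⟩ := Submodule.mem_span_singleton.1
      (h σ hσ z (Submodule.mem_span_singleton_self z))
    rw [hsmul] at hc
    have hσz : σ z ≠ 0 := by simpa using hz
    have hc0 : algebraMap k K c ≠ 0 := fun h0 => hσz (by rw [← hc, h0, zero_mul])
    rw [map_div₀, hσ z, ← hc, Derivation.leibniz, hconst, smul_zero, add_zero, smul_eq_mul,
      mul_div_mul_left _ _ hc0]
  · intro h
    refine ⟨finrank_span_singleton hz, fun σ hσ w hw => ?_⟩
    obtain ⟨c, rfl⟩ := Submodule.mem_span_singleton.1 hw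
    have hσz : σ z ≠ 0 := by simpa using hz
    have h1 := h σ hσ
    rw [map_div₀, hσ z, div_eq_div_iff hσz hz] at h1
    obtain ⟨a, ha, haz⟩ := hK (σ z / z) (by
      rw [Derivation.leibniz_div, smul_eq_mul, smul_eq_mul, mul_comm z, h1]
      ring_nf)
    rw [hsmul, map_mul, σ.commutes, ← hsmul]
    refine Submodule.smul_mem _ c (Submodule.mem_span_singleton.2 ⟨⟨a, ha⟩, ?_⟩)
    rw [hsmul]
    change algebraMap k K a * z = σ z
    rw [haz, div_mul_cancel₀ _ hz]

end Line

theorem mainTheorem7 {k R K : Type*} [Field k] [CharZero k] [Differential k]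
    (hC : IsAlgClosed (constantField k))
    (L : DiffOp k) (hL : L ≠ 0)
    [CommRing R] [Differential R] [Algebra k R] [DifferentialAlgebra k R]
    (hR : IsPicardVessiotRing L.companion R)
    [Field K] [Differential K] [Algebra k K] [DifferentialAlgebra k K]
    [Algebra R K] [DifferentialAlgebra R K] [IsScalarTower k R K] [IsFractionRing R K] :
    (∀ z ∈ L.solutionSpace K, z ≠ 0 →
      (SpansInvariantLine k z ↔ ∀ σ ∈ DGal k K, σ (z′ / z) = z′ / z) ∧
      (SpansInvariantLine k z ↔ ∃ u : k, algebraMap k K u = z′ / z) ∧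
      (SpansInvariantLine k z → ∃ u : k, algebraMap k K u = z′ / z ∧
        DiffOp.IsRightDivisor (DiffOp.partialOp - DiffOp.const u) L)) ∧
    (∀ u : k, DiffOp.IsRightDivisor (DiffOp.partialOp - DiffOp.const u) L →
      (∃ z ∈ L.solutionSpace K, z ≠ 0 ∧ z′ / z = algebraMap k K u) ∧
      (∀ z : K, z ≠ 0 → z′ / z = algebraMap k K u →
        z ∈ L.solutionSpace K ∧ SpansInvariantLine k z)) := by
  have := hC
  have hK (c : K) (hc : c′ = 0) : ∃ a : k, a′ = 0 ∧ algebraMap k K a = c := hR.exists_constant hc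
  have hfix (z : K) : (∀ σ ∈ DGal k K, σ (z′ / z) = z′ / z) ↔
      ∃ u : k, algebraMap k K u = z′ / z :=
    ⟨fun h => hR.mem_range_of_forall_DGal h, fun ⟨u, hu⟩ σ _ => by rw [← hu, σ.commutes]⟩
  have hderiv {z : K} (hz : z ≠ 0) {u : k} (hu : algebraMap k K u = z′ / z) :
      z′ = algebraMap k K u * z := by rw [hu, div_mul_cancel₀ _ hz]
  refine ⟨fun z hzV hz => ?_, fun u hu => ⟨?_, fun z hz hzu => ?_⟩⟩
  · have hline := spansInvariantLine_iff hK hz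
    refine ⟨hline, hline.trans (hfix z), fun h => ?_⟩
    obtain ⟨u, hu⟩ := (hfix z).1 (hline.1 h)
    exact ⟨u, hu, DiffOp.isRightDivisor_of_eval_eq_zero hz (hderiv hz hu) hzV⟩
  · obtain ⟨f, hf, hfu⟩ := hR.exists_deriv_eq_neg hL hu
    have hf0 : algebraMap R K f ≠ 0 := fun h =>
      hf (IsFractionRing.injective R K (h.trans (map_zero _).symm))
    -- Inverting `f` in `K` reverses the sign in `f′ = -u f`.
    have hz : (algebraMap R K f)⁻¹′ = algebraMap k K u * (algebraMap R K f)⁻¹ := by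
      rw [Derivation.leibniz_inv, deriv_algebraMap, hfu, map_neg, map_mul,
        ← IsScalarTower.algebraMap_apply, smul_eq_mul]
      field_simp
    refine ⟨_, DiffOp.eval_eq_zero_of_isRightDivisor hu hz, inv_ne_zero hf0, ?_⟩
    rw [hz, mul_div_cancel_right₀ _ (inv_ne_zero hf0)]
  · exact ⟨DiffOp.eval_eq_zero_of_isRightDivisor hu (hderiv hz hzu.symm),
      (spansInvariantLine_iff hK hz).2 ((hfix z).2 ⟨u, hzu.symm⟩)⟩
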